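/- **Model.** Let $n\ge 3$ players, one of them the General $\mathcal G$, be connected by a complete synchronous network with reliable authenticated point-to-point channels. A protocol $\Delta$ consists of a probabilistic polynomial-time (in a security parameter $k$) interactive machine for every player, a number of rounds bounded by a polynomial in $k$, and an arbitrary joint distribution, depending on $k$, of the players' setup tapes (signing and verification keys), which a trusted party generates and distributes beforehand. In every round each player computes locally, sends a message to every player, and receives the messages sent to it; after the last round it computes once more and outputs a string. The General has an input $v\in\{0,1\}$. Two executions $E_1,E_2$ of $\Delta$ run in parallel, with the same setup tapes, distinct session identifiers given to the players, independent coins and no shared state, for inputs $v_1,v_2\in\{0,1\}$ of the General chosen by the adversary. A probabilistic polynomial-time adversary $\mathcal A$ statically chooses sets $I_1,I_2$ of players that are Byzantine in $E_1$, $E_2$. It determines all messages and outputs of the players of $I_e$ in $E_e$; every other process follows $\Delta$, and is *passively corrupt* if its player belongs to $I_1\cup I_2$. $\mathcal A$ learns the setup tapes of all players of $I_1\cup I_2$, everything these players receive in both executions, and the coins of the passively corrupt processes; it acts jointly on both executions, and its messages of a round depend on what it has received in earlier rounds. A *$t$-adversary* is one with $|I_1\cup I_2|\le t$; a *$(t_1,t_2)$-adversary*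 is one with $|I_1|\le t_1$ and $|I_2|\le t_2$. In the *ideal process* for $E_e$ the General sends its input $v_e$ (if $\mathcal G\in I_e$: a value chosen by the ideal adversary $\mathcal S$) to a trusted party, which forwards it to all players and to $\mathcal S$; all players outside $I_e$, including the passively corrupt ones, output this value, and $\mathcal S$ determines the outputs of the players of $I_e$. The protocol $\Delta$ is an authenticated Byzantine Generals (ABG) protocol that *self-composes in parallel twice*, tolerating a given class of adversaries, if for every choice of $I_1,I_2$ and every $\mathcal A$ in the class and every $e\in\{1,2\}$ there is a probabilistic polynomial-time ideal adversary $\mathcal S$ such that the vector of the $n$ outputs in $E_e$ of the real process and that of the ideal process, as ensembles indexed by $k$ and $(v_1,v_2)$, are computationally indistinguishable. **Lemma.** Let $n\ge 3$, and fix any two distinct session identifiers. 1. If $n<2t$, then no ABG protocol over $n$ players, tolerating a $t$-adversary, self-composes in parallel even twice. 2. More generally, if $t_2>0$ and $n\le 2t_1+\min(t_1,t_2)$, then no ABG protocol over $n$ players, tolerating a $(t_1,t_2)$-adversary, self-composes in parallel even twice. -/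

import Mathlib

namespace ABG

/-! ### Polynomial-time computation

Programs act on named registers, each of which holds a bit string and is used as a stack. -/

/-- Registers of a machine with communication ports `P`: the security parameter in unary, random
tapes, work registers, and the ports. -/
inductive Reg (P : Type) : Type where
  | sec : Reg P
  | coin (i : ℕ) : Reg P
  | work (i : ℕ) : Reg P
  | port (p : P) : Reg P

/-- Contents of all registers. -/
abbrev Store (P : Type) : Type := Reg P → List Bool

open Classical in
/-- Overwrite one register. -/
noncomputable def Store.set {P : Type} (σ : Store P) (x : Reg P) (w : List Bool) : Store P :=
  fun y => if y = x then w else σ y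

/-- While programs over stacks of bits. -/
inductive Cmd (P : Type) : Type where
  | skip : Cmd P
  | push (b : Bool) (x : Reg P) : Cmd P
  | pop (x : Reg P) : Cmd P
  | copy (x y : Reg P) : Cmd P
  | seq (c d : Cmd P) : Cmd P
  | branch (x : Reg P) (cEmpty cFalse cTrue : Cmd P) : Cmd P
  | loop (x : Reg P) (c : Cmd P) : Cmd P

/-- The alternative of a `branch` that is taken when the tested register holds `w`. -/
def Cmd.select {P : Type} (w : List Bool) (cEmpty cFalse cTrue : Cmd P) : Cmd P :=
  match w with
  | [] => cEmpty
  | false :: _ => cFalse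
  | true :: _ => cTrue

/-- `Runs c σ t τ`: started on `σ`, the program `c` halts after `t` steps with contents `τ`.
`copy x y` is the assignment `x := y`; `loop x c` repeats `c` as long as `x` is nonempty.
One step makes the longest register longer by at most one bit, so that polynomially many steps
amount to polynomial time on a Turing machine. -/
inductive Runs {P : Type} : Cmd P → Store P → ℕ → Store P → Prop where
  | skip (σ : Store P) : Runs Cmd.skip σ 1 σ
  | push (b : Bool) (x : Reg P) (σ : Store P) : Runs (Cmd.push b x) σ 1 (σ.set x (b :: σ x))
  | pop (x : Reg P) (σ : Store P) : Runs (Cmd.pop x) σ 1 (σ.set x (σ x).tail)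
  | copy (x y : Reg P) (σ : Store P) : Runs (Cmd.copy x y) σ 1 (σ.set x (σ y))
  | seq {c d : Cmd P} {σ τ υ : Store P} {s t : ℕ} :
      Runs c σ s τ → Runs d τ t υ → Runs (Cmd.seq c d) σ (s + t) υ
  | branch {x : Reg P} {c₀ c₁ c₂ : Cmd P} {σ τ : Store P} {t : ℕ} :
      Runs (Cmd.select (σ x) c₀ c₁ c₂) σ t τ → Runs (Cmd.branch x c₀ c₁ c₂) σ (t + 1) τ
  | loop_stop {x : Reg P} {c : Cmd P} {σ : Store P} :
      σ x = [] → Runs (Cmd.loop x c) σ 1 σ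
  | loop_step {x : Reg P} {c : Cmd P} {σ τ υ : Store P} {s t : ℕ} :
      σ x ≠ [] → Runs c σ s τ → Runs (Cmd.loop x c) τ t υ →
        Runs (Cmd.loop x c) σ (s + t + 1) υ

/-- The string `1^k`. -/
def unary (k : ℕ) : List Bool := List.replicate k true

/-- The map `f` on register contents is computed by one program in time polynomial in the security
parameter, whatever the other registers hold. -/
def PolyTime {P : Type} (f : Store P → Store P) : Prop :=
  ∃ (c : Cmd P) (p : Polynomial ℕ), ∀ (k : ℕ) (σ : Store P), σ Reg.sec = unary k →
    ∃ t ≤ p.eval k, Runs c σ t (f σ)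

/-- A probabilistic polynomial-time machine with ports `P`.  It keeps its registers between
activations; `step` is the local computation of one activation.  It has finitely many random
tapes, the `i`-th of length `tapeLen i`, a polynomial in the security parameter. -/
structure Machine (P : Type) : Type where
  step : Store P → Store P
  polyTime : PolyTime step
  tapes : ℕ
  tapeLen : Fin tapes → Polynomial ℕ

/-- The possible contents of the random tapes of a machine. -/
abbrev Machine.Tapes {P : Type} (M : Machine P) (k : ℕ) : Type :=
  (i : Fin M.tapes) → Fin ((M.tapeLen i).eval k) → Bool

/-- The contents of random tape number `i` as a bit string (empty if there is no such tape). -/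
def Machine.tapeString {P : Type} (M : Machine P) {k : ℕ} (r : M.Tapes k) (i : ℕ) : List Bool :=
  if h : i < M.tapes then List.ofFn (r ⟨i, h⟩) else []

/-- Initial register contents: the random tapes `r` and the strings `init` on the ports. -/
def Machine.start {P : Type} (M : Machine P) {k : ℕ} (r : M.Tapes k) (init : P → List Bool) :
    Store P
  | Reg.sec => unary k
  | Reg.coin i => M.tapeString r i
  | Reg.work _ => []
  | Reg.port p => init p

/-- One activation with security parameter `k`. -/
noncomputable def Machine.activate {P : Type} (M : Machine P) (k : ℕ) (σ : Store P) : Store P :=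
  M.step (σ.set Reg.sec (unary k))

/-! ### Protocols -/

/-- Ports of a process executed by one of `n` players: the last message received from player `j`,
the message to be sent to player `j`, the setup tape, the session identifier, the input (of the
General) and the output. -/
inductive PlayerPort (n : ℕ) : Type where
  | recv (j : Fin n) : PlayerPort n
  | send (j : Fin n) : PlayerPort n
  | setup : PlayerPort n
  | sid : PlayerPort n
  | input : PlayerPort n
  | result : PlayerPort n

/-- A synchronous protocol for `n` players with a trusted preprocessing phase: `setup k` is the
joint distribution of the setup tapes (signing keys, verification keys, ...), which is arbitrary. -/
structure Protocol (n : ℕ) : Type where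
  general : Fin n
  machine : Fin n → Machine (PlayerPort n)
  setup : ℕ → PMF (Fin n → List Bool)
  rounds : ℕ → ℕ
  rounds_le : ∃ p : Polynomial ℕ, ∀ k, rounds k ≤ p.eval k

/-! ### The real process: `m` parallel executions under attack -/

/-- A choice of players for Byzantine corruption in each of `m` parallel executions. -/
abbrev Corruption (m n : ℕ) : Type := Fin m → Finset (Fin n)

/-- The players corrupted in at least one execution.  A process of such a player, in an execution in
which the player is not Byzantine, is passively corrupt. -/
def Corruption.players {m n : ℕ} (C : Corruption m n) : Finset (Fin n) :=
  Finset.univ.biUnion C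

/-- Ports of the adversary: session identifier and General's input in execution `e`; setup tape of a
corrupted player; random tape number `s` of the passively corrupt process of player `i` in execution
`e`; last message received by corrupted player `i` from `j` in execution `e`; message to be sent in
the name of `i` to `j`, and output of `i`, in execution `e`, if `i` is Byzantine there. -/
inductive AdvPort (m n : ℕ) : Type where
  | sid (e : Fin m) : AdvPort m n
  | input (e : Fin m) : AdvPort m n
  | setup (i : Fin n) : AdvPort m n
  | tape (e : Fin m) (i : Fin n) (s : ℕ) : AdvPort m n
  | recv (e : Fin m) (i j : Fin n) : AdvPort m n
  | send (e : Fin m) (i j : Fin n) : AdvPort m n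
  | result (e : Fin m) (i : Fin n) : AdvPort m n

/-- Register contents of all processes and of the adversary. -/
structure Config (m n : ℕ) : Type where
  proc : Fin m → Fin n → Store (PlayerPort n)
  adv : Store (AdvPort m n)

section Real

variable {m n : ℕ} (Δ : Protocol n) (C : Corruption m n) (A : Machine (AdvPort m n))

/-- Random tapes of all processes and of the adversary. -/
abbrev Coins (k : ℕ) : Type :=
  (Fin m → (i : Fin n) → (Δ.machine i).Tapes k) × A.Tapes k

/-- The initial configuration for session identifiers `sid`, inputs `v` of the General and setup
tapes `s`.  All executions use the same setup tapes. -/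
def initial (sid : Fin m → List Bool) {k : ℕ} (v : Fin m → Bool) (s : Fin n → List Bool)
    (r : Coins Δ A (m := m) k) : Config m n where
  proc e i := (Δ.machine i).start (r.1 e i) fun
    | PlayerPort.setup => s i
    | PlayerPort.sid => sid e
    | PlayerPort.input => if i = Δ.general then [v e] else []
    | PlayerPort.recv _ => []
    | PlayerPort.send _ => []
    | PlayerPort.result => []
  adv := A.start r.2 fun
    | AdvPort.sid e => sid e
    | AdvPort.input e => [v e]
    | AdvPort.setup i => if i ∈ C.players then s i else []
    | AdvPort.tape e i j =>
        if i ∈ C.players ∧ i ∉ C e then (Δ.machine i).tapeString (r.1 e i) j else []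
    | AdvPort.recv _ _ _ => []
    | AdvPort.send _ _ _ => []
    | AdvPort.result _ _ => []

/-- Local computation of all processes that are not Byzantine, and of the adversary. -/
noncomputable def compute (k : ℕ) (S : Config m n) : Config m n where
  proc e i := if i ∈ C e then S.proc e i else (Δ.machine i).activate k (S.proc e i)
  adv := A.activate k S.adv

/-- The message from `i` to `j` in execution `e`. -/
def message (S : Config m n) (e : Fin m) (i j : Fin n) : List Bool :=
  if i ∈ C e then S.adv (Reg.port (AdvPort.send e i j))
  else S.proc e i (Reg.port (PlayerPort.send j))

/-- Delivery of all messages; the adversary sees what the corrupted players receive. -/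
def deliver (S : Config m n) : Config m n where
  proc e i
    | Reg.port (PlayerPort.recv j) => message C S e j i
    | x => S.proc e i x
  adv
    | Reg.port (AdvPort.recv e i j) => if i ∈ C.players then message C S e j i else []
    | x => S.adv x

/-- The output of player `i` in execution `e`. -/
def output (S : Config m n) (e : Fin m) (i : Fin n) : List Bool :=
  if i ∈ C e then S.adv (Reg.port (AdvPort.result e i))
  else S.proc e i (Reg.port PlayerPort.result)

/-- The configuration at the end: in every round the processes compute, then all messages of the
round are delivered; there is a last local computation after the last round. -/
noncomputable def final (k : ℕ) (S : Config m n) : Config m n :=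
  compute Δ C A k ((fun T => deliver C (compute Δ C A k T))^[Δ.rounds k] S)

/-- The outputs of the `n` players in execution `e` of the real process. -/
noncomputable def real (sid : Fin m → List Bool) (e : Fin m) (k : ℕ) (v : Fin m → Bool) :
    PMF (Fin n → List Bool) :=
  (Δ.setup k).bind fun s =>
    (PMF.uniformOfFintype (Coins Δ A (m := m) k)).map fun r =>
      output C (final Δ C A k (initial Δ C A sid v s r)) e

end Real

/-! ### The ideal process -/

/-- Ports of an ideal-process adversary: the inputs of the General, the value that a corrupted
General sends to the trusted party, the outputs of the corrupted players. -/
inductive IdealPort (m n : ℕ) : Type where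
  | input (e : Fin m) : IdealPort m n
  | send : IdealPort m n
  | result (i : Fin n) : IdealPort m n

/-- The outputs of the `n` players in the ideal process that corresponds to execution `e`, with
General `g` and the players in `I` corrupted: the trusted party forwards the General's value, the
players outside `I` output it, and the adversary determines all other outputs. -/
noncomputable def ideal {m n : ℕ} (g : Fin n) (I : Finset (Fin n)) (S : Machine (IdealPort m n))
    (e : Fin m) (k : ℕ) (v : Fin m → Bool) : PMF (Fin n → List Bool) :=
  (PMF.uniformOfFintype (S.Tapes k)).map fun r =>
    let τ : Store (IdealPort m n) := S.activate k (S.start r fun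
      | IdealPort.input e' => [v e']
      | IdealPort.send => []
      | IdealPort.result _ => [])
    let w : List Bool := if g ∈ I then τ (Reg.port IdealPort.send) else [v e]
    fun i => if i ∈ I then τ (Reg.port (IdealPort.result i)) else w

/-! ### Computational indistinguishability -/

/-- Ports of a distinguisher: the index of the ensemble, the sample, the verdict. -/
inductive DistPort (m n : ℕ) : Type where
  | index (e : Fin m) : DistPort m n
  | sample (i : Fin n) : DistPort m n
  | verdict : DistPort m n

/-- The probability that `D` accepts a sample of `X`. -/
noncomputable def acceptProb {m n : ℕ} (D : Machine (DistPort m n)) (k : ℕ) (v : Fin m → Bool)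
    (X : PMF (Fin n → List Bool)) : ℝ :=
  ((X.bind fun x => (PMF.uniformOfFintype (D.Tapes k)).map fun r =>
    D.activate k (D.start r fun
      | DistPort.index e => [v e]
      | DistPort.sample i => x i
      | DistPort.verdict => []) (Reg.port DistPort.verdict)) [true]).toReal

/-- Computational indistinguishability of two ensembles indexed by the security parameter and the
inputs: every probabilistic polynomial-time distinguisher has negligible advantage. -/
def Indistinguishable {m n : ℕ} (X Y : ℕ → (Fin m → Bool) → PMF (Fin n → List Bool)) : Prop :=
  ∀ (D : Machine (DistPort m n)) (v : Fin m → Bool),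
    Asymptotics.SuperpolynomialDecay Filter.atTop (fun k : ℕ => (k : ℝ))
      fun k => |acceptProb D k v (X k v) - acceptProb D k v (Y k v)|

/-! ### Composable authenticated Byzantine Generals -/

/-- `Δ` meets the requirements of authenticated Byzantine Generals in each of `m` parallel
executions with session identifiers `sid`, for all corruptions that satisfy `adm`.  For `m = 1`
this is the stand-alone requirement. -/
def ParallelABG {m n : ℕ} (Δ : Protocol n) (sid : Fin m → List Bool)
    (adm : Corruption m n → Prop) : Prop :=
  ∀ C : Corruption m n, adm C → ∀ A : Machine (AdvPort m n), ∀ e : Fin m,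
    ∃ S : Machine (IdealPort m n),
      Indistinguishable (ideal Δ.general (C e) S e) (real Δ C A sid e)

/-- A `t`-adversary corrupts at most `t` players, each of them in all or only in some of the
executions. -/
def IsThreshold {m n : ℕ} (t : ℕ) (C : Corruption m n) : Prop := C.players.card ≤ t

/-- A `(t₁, t₂)`-adversary corrupts at most `t₁` players in the first and at most `t₂` players in the
second of two parallel executions. -/
def IsPairThreshold {n : ℕ} (t₁ t₂ : ℕ) (C : Corruption 2 n) : Prop :=
  (C 0).card ≤ t₁ ∧ (C 1).card ≤ t₂

end ABG

namespace ABG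

/-! ### Programs -/

/-! The proof is a covering argument in the style of Fischer, Lynch and Merritt. Divide the players
into three nonempty classes: A, which contains the General, B and C. Take two copies A₀ and A₁ of A,
with General's inputs 0 and 1, and one copy each of B and C, and connect them as a path A₀ – B – C –
A₁: each of B and C listens to the copy of A next to it, and A₀ hears nothing from C, A₁ nothing
from B. All nodes use the same setup tapes and the session identifier of the first execution.

Each pair of neighbours on the path is the honest part of an attacked first execution. With A₀ and B
honest and C Byzantine, validity makes B output 0 with probability tending to 1. With C and A₁
honest and B Byzantine, C outputs 0 with probability tending to 0. With B and C honest and A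
Byzantine, agreement makes these two probabilities asymptotically equal, a contradiction
(`not_parallelABG_of_classes`).

In the first two attacks the adversary runs a second copy of A although A is honest in the first
execution. Authentication would prevent this in a single execution; but A is Byzantine in the second
execution, and this hands over its setup tapes. Nothing else about the second execution matters,
except that its General's input supplies the opposite bit.

The simulation is exact. `Tracks` and `TracksSent` are invariants that match an attacked execution
with the path, and `map_pullCoins` matches the random tapes; together they give `map_real_eq`. The
numerical hypotheses enter only through `exists_classes`, which makes the classes small enough for
the attacks to be admissible. -/

theorem Store.set_same {P : Type} (σ : Store P) (x : Reg P) (w : List Bool) : σ.set x w x = w := by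
  simp [Store.set]

theorem Store.set_of_ne {P : Type} (σ : Store P) {x y : Reg P} (w : List Bool) (h : y ≠ x) :
    σ.set x w y = σ y := by
  simp [Store.set, h]

theorem Store.set_self {P : Type} (σ : Store P) {x : Reg P} {w : List Bool} (h : σ x = w) :
    σ.set x w = σ := by
  funext y
  by_cases hy : y = x
  · subst hy; rw [Store.set_same, h]
  · rw [Store.set_of_ne _ _ hy]

/-- Rename the registers of a program. -/
def Cmd.rename {P Q : Type} (φ : Reg P → Reg Q) : Cmd P → Cmd Q
  | Cmd.skip => Cmd.skip
  | Cmd.push b x => Cmd.push b (φ x)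
  | Cmd.pop x => Cmd.pop (φ x)
  | Cmd.copy x y => Cmd.copy (φ x) (φ y)
  | Cmd.seq c d => Cmd.seq (c.rename φ) (d.rename φ)
  | Cmd.branch x c d e => Cmd.branch (φ x) (c.rename φ) (d.rename φ) (e.rename φ)
  | Cmd.loop x c => Cmd.loop (φ x) (c.rename φ)

theorem Cmd.rename_select {P Q : Type} (φ : Reg P → Reg Q) (w : List Bool) (c d e : Cmd P) :
    (Cmd.select w c d e).rename φ = Cmd.select w (c.rename φ) (d.rename φ) (e.rename φ) := by
  rcases w with _ | ⟨_ | _, _⟩ <;> rfl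

theorem extend_set {P Q : Type} {φ : Reg P → Reg Q} (hφ : Function.Injective φ) (σ : Store P)
    (ρ : Store Q) (x : Reg P) (w : List Bool) :
    Function.extend φ (σ.set x w) ρ = Store.set (Function.extend φ σ ρ) (φ x) w := by
  funext y
  by_cases hy : ∃ z, φ z = y
  · obtain ⟨z, rfl⟩ := hy
    by_cases hz : z = x
    · subst hz; rw [hφ.extend_apply, Store.set_same, Store.set_same]
    · rw [hφ.extend_apply, Store.set_of_ne _ _ hz, Store.set_of_ne _ _ (fun h => hz (hφ h)),
        hφ.extend_apply]
  · rw [Function.extend_apply' _ _ _ hy, Store.set_of_ne _ _ (fun h => hy ⟨x, h.symm⟩),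
      Function.extend_apply' _ _ _ hy]

/-- A renamed program acts on the renamed registers as the original one and leaves all other
registers alone. -/
theorem Runs.rename {P Q : Type} {φ : Reg P → Reg Q} (hφ : Function.Injective φ) (ρ : Store Q)
    {c : Cmd P} {σ τ : Store P} {t : ℕ} (h : Runs c σ t τ) :
    Runs (c.rename φ) (Function.extend φ σ ρ) t (Function.extend φ τ ρ) := by
  induction h with
  | skip σ => exact Runs.skip _
  | push b x σ =>
    have := Runs.push b (φ x) (Function.extend φ σ ρ)
    rwa [hφ.extend_apply, ← extend_set hφ] at this
  | pop x σ =>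
    have := Runs.pop (φ x) (Function.extend φ σ ρ)
    rwa [hφ.extend_apply, ← extend_set hφ] at this
  | copy x y σ =>
    have := Runs.copy (φ x) (φ y) (Function.extend φ σ ρ)
    rwa [hφ.extend_apply, ← extend_set hφ] at this
  | seq _ _ ih₁ ih₂ => exact Runs.seq ih₁ ih₂
  | branch _ ih =>
    refine Runs.branch ?_
    rwa [hφ.extend_apply, ← Cmd.rename_select]
  | loop_stop h => exact Runs.loop_stop (by rwa [hφ.extend_apply])
  | loop_step h _ _ ih₁ ih₂ => exact Runs.loop_step (by rwa [hφ.extend_apply]) ih₁ ih₂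

/-! ### Closure properties of polynomial time -/

theorem PolyTime.id {P : Type} : PolyTime (fun σ : Store P => σ) :=
  ⟨Cmd.skip, 1, fun _ σ _ => ⟨1, by simp, Runs.skip σ⟩⟩

theorem PolyTime.push {P : Type} (b : Bool) (x : Reg P) :
    PolyTime (fun σ : Store P => σ.set x (b :: σ x)) :=
  ⟨Cmd.push b x, 1, fun _ σ _ => ⟨1, by simp, Runs.push b x σ⟩⟩

theorem PolyTime.pop {P : Type} (x : Reg P) : PolyTime (fun σ : Store P => σ.set x (σ x).tail) :=
  ⟨Cmd.pop x, 1, fun _ σ _ => ⟨1, by simp, Runs.pop x σ⟩⟩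

theorem PolyTime.copy {P : Type} (x y : Reg P) : PolyTime (fun σ : Store P => σ.set x (σ y)) :=
  ⟨Cmd.copy x y, 1, fun _ σ _ => ⟨1, by simp, Runs.copy x y σ⟩⟩

/-- The step bound depends on the security parameter alone, whatever the other registers hold. Hence
no bound on intermediate lengths is needed, and the times simply add; only the register `Reg.sec`
must survive `f`. -/
theorem PolyTime.comp {P : Type} {f g : Store P → Store P} (hg : PolyTime g) (hf : PolyTime f)
    (hsec : ∀ σ, f σ Reg.sec = σ Reg.sec) : PolyTime (fun σ => g (f σ)) := by
  obtain ⟨c, p, hc⟩ := hf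
  obtain ⟨d, q, hd⟩ := hg
  refine ⟨Cmd.seq c d, p + q, fun k σ hσ => ?_⟩
  obtain ⟨s, hs, hrs⟩ := hc k σ hσ
  obtain ⟨t, ht, hrt⟩ := hd k (f σ) ((hsec σ).trans hσ)
  exact ⟨s + t, by rw [Polynomial.eval_add]; exact add_le_add hs ht, Runs.seq hrs hrt⟩

theorem PolyTime.branch {P : Type} (x : Reg P) {f₀ f₁ f₂ : Store P → Store P}
    (h₀ : PolyTime f₀) (h₁ : PolyTime f₁) (h₂ : PolyTime f₂) :
    PolyTime (fun σ => match σ x with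
      | [] => f₀ σ
      | false :: _ => f₁ σ
      | true :: _ => f₂ σ) := by
  obtain ⟨c₀, p₀, h₀⟩ := h₀
  obtain ⟨c₁, p₁, h₁⟩ := h₁
  obtain ⟨c₂, p₂, h₂⟩ := h₂
  refine ⟨Cmd.branch x c₀ c₁ c₂, p₀ + p₁ + p₂ + 1, fun k σ hσ => ?_⟩
  obtain ⟨t₀, ht₀, hr₀⟩ := h₀ k σ hσ
  obtain ⟨t₁, ht₁, hr₁⟩ := h₁ k σ hσ
  obtain ⟨t₂, ht₂, hr₂⟩ := h₂ k σ hσ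
  simp only [Polynomial.eval_add, Polynomial.eval_one]
  rcases hx : σ x with _ | ⟨_ | _, w⟩
  · exact ⟨t₀ + 1, by omega, Runs.branch (by rw [hx]; exact hr₀)⟩
  · exact ⟨t₁ + 1, by omega, Runs.branch (by rw [hx]; exact hr₁)⟩
  · exact ⟨t₂ + 1, by omega, Runs.branch (by rw [hx]; exact hr₂)⟩

theorem PolyTime.ite_eq_nil {P : Type} (x : Reg P) {f g : Store P → Store P}
    (hf : PolyTime f) (hg : PolyTime g) :
    PolyTime (fun σ => if σ x = [] then f σ else g σ) := by
  convert PolyTime.branch x hf hg hg using 2 with σ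
  rcases σ x with _ | ⟨_ | _, w⟩ <;> simp

/-- Finitely many simultaneous assignments. -/
noncomputable def assign {P ι : Type} (target source : ι → Reg P) (σ : Store P) : Store P :=
  Function.extend target (fun a => σ (source a)) σ

theorem assign_of_ne {P ι : Type} (target source : ι → Reg P) (σ : Store P) {y : Reg P}
    (hy : ∀ a, target a ≠ y) : assign target source σ y = σ y :=
  Function.extend_apply' _ _ _ (by rintro ⟨a, h⟩; exact hy a h)

theorem assign_target {P ι : Type} {target : ι → Reg P} (hinj : Function.Injective target)
    (source : ι → Reg P) (σ : Store P) (a : ι) :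
    assign target source σ (target a) = σ (source a) :=
  hinj.extend_apply _ _ a

/-- No target is a source, so copying one register after another has the effect of the simultaneous
assignment. -/
theorem polyTime_assign {P ι : Type} [Finite ι] {target source : ι → Reg P}
    (hinj : Function.Injective target) (hdisj : ∀ a b, target a ≠ source b) :
    PolyTime (assign target source) := by
  have key : ∀ l : List ι, ∃ (c : Cmd P) (T : ℕ), ∀ σ : Store P, ∃ τ : Store P, Runs c σ T τ ∧
      (∀ a ∈ l, τ (target a) = σ (source a)) ∧
      ∀ x, (∀ a ∈ l, target a ≠ x) → τ x = σ x := by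
    intro l
    induction l with
    | nil => exact ⟨Cmd.skip, 1, fun σ => ⟨σ, Runs.skip σ, by simp, fun _ _ => rfl⟩⟩
    | cons a l ih =>
      obtain ⟨c, T, hc⟩ := ih
      refine ⟨Cmd.seq c (Cmd.copy (target a) (source a)), T + 1, fun σ => ?_⟩
      obtain ⟨τ, hr, hl, hx⟩ := hc σ
      have hs : τ (source a) = σ (source a) := hx _ fun b _ => hdisj b a
      refine ⟨_, Runs.seq hr (Runs.copy _ _ τ), fun b hb => ?_, fun x hne => ?_⟩
      · by_cases hba : b = a
        · subst hba; rw [Store.set_same, hs]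
        · rw [Store.set_of_ne _ _ (fun h => hba (hinj h))]
          exact hl b ((List.mem_cons.1 hb).resolve_left hba)
      · rw [Store.set_of_ne _ _ (fun h => hne a List.mem_cons_self h.symm)]
        exact hx x fun b hb => hne b (List.mem_cons_of_mem _ hb)
  have := Fintype.ofFinite ι
  obtain ⟨c, T, hc⟩ := key (Finset.univ : Finset ι).toList
  refine ⟨c, Polynomial.C T, fun k σ _ => ⟨T, by simp, ?_⟩⟩
  obtain ⟨τ, hr, hl, hx⟩ := hc σ
  convert hr
  funext y
  by_cases hy : ∃ a, target a = y
  · obtain ⟨a, rfl⟩ := hy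
    rw [assign, hinj.extend_apply, hl a (by simp)]
  · rw [assign, Function.extend_apply' _ _ _ hy, hx y fun a _ h => hy ⟨a, h⟩]

/-- One activation of each machine of a family, each machine on its own block of registers. -/
noncomputable def activateAll {P Q ι : Type} (M : ι → Machine P) (block : ι × Reg P → Reg Q)
    (σ : Store Q) : Store Q :=
  Function.extend block
    (fun a => (M a.1).step (Store.set (fun x => σ (block (a.1, x))) Reg.sec (σ Reg.sec)) a.2) σ

/-- The blocks are disjoint, so the renamed programs can run one after another without disturbing
each other. -/
theorem polyTime_activateAll {P Q ι : Type} [Finite ι] (M : ι → Machine P)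
    {block : ι × Reg P → Reg Q} (hinj : Function.Injective block)
    (hsec : ∀ a, block a ≠ Reg.sec) : PolyTime (activateAll M block) := by
  have key : ∀ l : List ι, l.Nodup → ∃ (c : Cmd Q) (p : Polynomial ℕ), ∀ (k : ℕ) (σ : Store Q),
      σ Reg.sec = unary k → ∃ t ≤ p.eval k, ∃ τ : Store Q, Runs c σ t τ ∧
      (∀ i ∈ l, ∀ x, τ (block (i, x)) =
        (M i).step (Store.set (fun x => σ (block (i, x))) Reg.sec (σ Reg.sec)) x) ∧
      ∀ y, (∀ i ∈ l, ∀ x, block (i, x) ≠ y) → τ y = σ y := by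
    intro l
    induction l with
    | nil =>
      exact fun _ => ⟨Cmd.skip, 1, fun k σ _ => ⟨1, by simp, σ, Runs.skip σ, by simp,
        fun _ _ => rfl⟩⟩
    | cons i l ih =>
      intro hl
      obtain ⟨hi, hl⟩ := List.nodup_cons.1 hl
      obtain ⟨c, p, hc⟩ := ih hl
      obtain ⟨d, q, hd⟩ := (M i).polyTime
      have hφ : Function.Injective fun x => block (i, x) := fun x y h => by
        simpa using hinj h
      -- The security parameter is first copied into the block, where the renamed program expects
      -- it.
      refine ⟨Cmd.seq c (Cmd.seq (Cmd.copy (block (i, Reg.sec)) Reg.sec)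
        (d.rename fun x => block (i, x))), p + (1 + q), fun k σ hσ => ?_⟩
      obtain ⟨s, hs, τ, hr, hτl, hτ⟩ := hc k σ hσ
      have hτsec : τ Reg.sec = σ Reg.sec := hτ _ fun j _ x => hsec _
      have hτi : ∀ x, τ (block (i, x)) = σ (block (i, x)) := fun x => hτ _ fun j hj y h => hi <| by
        have hji : j = i := (Prod.ext_iff.1 (hinj h)).1
        exact hji ▸ hj
      set ρ : Store P := Store.set (fun x => σ (block (i, x))) Reg.sec (σ Reg.sec) with hρ
      obtain ⟨t, ht, hrt⟩ := hd k ρ (by rw [hρ, Store.set_same, hσ])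
      have hext : Function.extend (fun x => block (i, x)) ρ τ =
          Store.set τ (block (i, Reg.sec)) (τ Reg.sec) := by
        rw [hρ, extend_set hφ, hτsec]
        congr 1
        funext y
        by_cases hy : ∃ x, block (i, x) = y
        · obtain ⟨x, rfl⟩ := hy
          exact (hφ.extend_apply _ _ x).trans (hτi x).symm
        · exact Function.extend_apply' _ _ _ hy
      have hr' := Runs.rename hφ τ hrt
      rw [hext] at hr'
      refine ⟨s + (1 + t), ?_, _, Runs.seq hr (Runs.seq (Runs.copy _ _ τ) hr'), ?_, ?_⟩
      · simp only [Polynomial.eval_add, Polynomial.eval_one]; omega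
      · intro j hj x
        by_cases hji : j = i
        · subst hji
          exact hφ.extend_apply _ _ x
        · rw [Function.extend_apply' _ _ _ (by
            rintro ⟨y, hy⟩
            exact hji (Prod.ext_iff.1 (hinj hy)).1.symm)]
          exact hτl j ((List.mem_cons.1 hj).resolve_left hji) x
      · intro y hy
        rw [Function.extend_apply' _ _ _ (by
            rintro ⟨x, hx⟩
            exact hy i List.mem_cons_self x hx)]
        exact hτ y fun j hj => hy j (List.mem_cons_of_mem _ hj)
  have := Fintype.ofFinite ι
  obtain ⟨c, p, hc⟩ := key _ (Finset.nodup_toList (Finset.univ : Finset ι))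
  refine ⟨c, p, fun k σ hσ => ?_⟩
  obtain ⟨t, ht, τ, hr, hl, hx⟩ := hc k σ hσ
  refine ⟨t, ht, ?_⟩
  convert hr
  funext y
  by_cases hy : ∃ a, block a = y
  · obtain ⟨⟨i, x⟩, rfl⟩ := hy
    rw [activateAll, hinj.extend_apply, hl i (by simp)]
  · rw [activateAll, Function.extend_apply' _ _ _ hy, hx y fun i _ x h => hy ⟨_, h⟩]

/-! ### Uniform distributions and distinguishers -/

/-- `put` identifies `α` with the product of `β` and any one fibre of `f`, so all fibres have the
same size. -/
theorem map_uniformOfFintype_of_lens {α β : Type} [Fintype α] [Nonempty α] [Fintype β]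
    [Nonempty β] (f : α → β) (put : β → α → α) (get_put : ∀ b a, f (put b a) = b)
    (put_get : ∀ a, put (f a) a = a) (put_put : ∀ b b' a, put b (put b' a) = put b a) :
    (PMF.uniformOfFintype α).map f = PMF.uniformOfFintype β := by
  classical
  have hcard : ∀ b, Fintype.card α = Fintype.card β * Fintype.card {a // b = f a} := by
    intro b
    rw [← Fintype.card_prod]
    refine Fintype.card_congr ⟨fun a => (f a, ⟨put b a, (get_put b a).symm⟩),
      fun x => put x.1 x.2.1, fun a => ?_, fun x => ?_⟩
    · simp only [put_put, put_get]
    · obtain ⟨c, a, rfl⟩ := x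
      simp only [put_put, put_get, get_put]
  ext b
  rw [PMF.map_apply, tsum_fintype, PMF.uniformOfFintype_apply]
  simp only [PMF.uniformOfFintype_apply]
  rw [← Finset.sum_filter, Finset.sum_const, nsmul_eq_mul, ← Fintype.card_subtype, hcard b]
  have h0 : Fintype.card {a // b = f a} ≠ 0 := by
    intro h
    have := hcard b
    rw [h, mul_zero] at this
    exact Fintype.card_ne_zero this
  push_cast
  rw [ENNReal.mul_inv (Or.inr (ENNReal.natCast_ne_top _)) (Or.inl (ENNReal.natCast_ne_top _)),
    mul_left_comm, ENNReal.mul_inv_cancel (by exact_mod_cast h0) (ENNReal.natCast_ne_top _),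
    mul_one]

/-- The distinguisher that accepts when player `i` outputs `0`. -/
noncomputable def zeroTest (m : ℕ) {n : ℕ} (i : Fin n) : Machine (DistPort m n) where
  step σ := match σ (Reg.port (DistPort.sample i)) with
    | [] => σ
    | false :: _ => (fun τ : Store (DistPort m n) =>
        if τ (Reg.port (DistPort.sample i)) = [] then
          τ.set (Reg.port DistPort.verdict) (true :: τ (Reg.port DistPort.verdict)) else τ)
        (σ.set (Reg.port (DistPort.sample i)) (σ (Reg.port (DistPort.sample i))).tail)
    | true :: _ => σ
  polyTime := PolyTime.branch _ PolyTime.id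
    (PolyTime.comp (PolyTime.ite_eq_nil _ (PolyTime.push _ _) PolyTime.id) (PolyTime.pop _)
      fun σ => Store.set_of_ne _ _ (by simp)) PolyTime.id
  tapes := 0
  tapeLen _ := 0

theorem acceptProb_zeroTest {m n : ℕ} (i : Fin n) (k : ℕ) (v : Fin m → Bool)
    (X : PMF (Fin n → List Bool)) :
    acceptProb (zeroTest m i) k v X = ((X.map fun x => x i) [false]).toReal := by
  classical
  have h : ∀ (x : Fin n → List Bool) (r : (zeroTest m i).Tapes k),
      (zeroTest m i).activate k ((zeroTest m i).start r fun
        | DistPort.index e => [v e]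
        | DistPort.sample i => x i
        | DistPort.verdict => []) (Reg.port DistPort.verdict)
      = if x i = [false] then [true] else [] := by
    intro x r
    rcases hx : x i with _ | ⟨_ | _, _ | ⟨b, w⟩⟩ <;>
      simp [Machine.activate, zeroTest, Store.set, Machine.start, hx]
  unfold acceptProb
  congr 1
  rw [PMF.map_apply, PMF.bind_apply]
  refine tsum_congr fun x => ?_
  -- The verdict does not depend on the coins, so its distribution is a point mass.
  have hc := (congrArg (fun f => (PMF.uniformOfFintype ((zeroTest m i).Tapes k)).map f)
    (funext (h x))).trans
    (PMF.map_const _ (if x i = [false] then [true] else []))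
  refine (congrArg (fun p : PMF (List Bool) => X x * p [true]) hc).trans ?_
  rw [PMF.pure_apply]
  by_cases hx : x i = [false]
  · simp [hx]
  · simp [hx, Ne.symm hx]

/-- Validity, which holds exactly in the ideal process, whatever `S` does. -/
theorem ideal_map_of_general_honest {m n : ℕ} {g i : Fin n} {I : Finset (Fin n)} (hg : g ∉ I)
    (hi : i ∉ I) (S : Machine (IdealPort m n)) (e : Fin m) (k : ℕ) (v : Fin m → Bool) :
    (ideal g I S e k v).map (fun x => x i) = PMF.pure [v e] := by
  simp only [ideal, PMF.map_comp]
  exact (congrArg (fun f => PMF.map f _) (funext fun r => by simp [hg, hi])).trans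
    (PMF.map_const _ _)

/-- Agreement, with a possibly corrupted General: both outputs are the value of the trusted party,
the same function of the coins of `S`. -/
theorem ideal_map_eq {m n : ℕ} (g : Fin n) {i j : Fin n} {I : Finset (Fin n)} (hi : i ∉ I)
    (hj : j ∉ I) (S : Machine (IdealPort m n)) (e : Fin m) (k : ℕ) (v : Fin m → Bool) :
    (ideal g I S e k v).map (fun x => x i) = (ideal g I S e k v).map (fun x => x j) := by
  simp only [ideal, PMF.map_comp]
  exact congrArg (fun f => PMF.map f _) (funext fun r => by simp [hi, hj])

/-! ### The chain

Two copies of every player, with the General's input equal to the name of the copy.  A player of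
type `none` takes part with both copies, a player of type `some b` with its copy `b` only; the
copies of the players of type `none` receive nothing from the players of the opposite type. -/

/-- A copy of a player. -/
abbrev Node (n : ℕ) : Type := Bool × Fin n

section Chain

variable {n : ℕ} (Δ : Protocol n) (κ : Fin n → Option Bool)

/-- The copy of player `i` that sends to the node `w`. -/
def route (w : Node n) (i : Fin n) : Option Bool :=
  match κ i, κ w.2 with
  | none, _ => some w.1
  | some c, none => if c = w.1 then some c else none
  | some c, some _ => some c

/-- The nodes that take part. -/
def Live (w : Node n) : Prop := κ w.2 = none ∨ κ w.2 = some w.1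

-- Live nodes hear only from live nodes. Hence the simulation need be correct only on them, and the
-- other copies, whose setup tapes may be unknown, do no harm.
variable {κ} in
theorem Live.of_route {w : Node n} (hw : Live κ w) {i : Fin n} {b : Bool}
    (h : route κ w i = some b) : Live κ (b, i) := by
  unfold route at h
  unfold Live at *
  rcases hi : κ i with _ | c <;> rcases hj : κ w.2 with _ | d <;> simp_all

/-- Random tapes of all nodes. -/
abbrev NodeCoins (k : ℕ) : Type := (w : Node n) → (Δ.machine w.2).Tapes k

/-- Initial contents of the registers of all nodes. -/
def chainInitial (sid : List Bool) {k : ℕ} (s : Fin n → List Bool) (r : NodeCoins Δ k)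
    (w : Node n) : Store (PlayerPort n) :=
  (Δ.machine w.2).start (r w) fun
    | PlayerPort.setup => s w.2
    | PlayerPort.sid => sid
    | PlayerPort.input => if w.2 = Δ.general then [w.1] else []
    | PlayerPort.recv _ => []
    | PlayerPort.send _ => []
    | PlayerPort.result => []

/-- Local computation of all nodes. -/
noncomputable def chainCompute (k : ℕ) (X : Node n → Store (PlayerPort n)) (w : Node n) :
    Store (PlayerPort n) :=
  (Δ.machine w.2).activate k (X w)

/-- The message that the node `w` receives from player `i`. -/
def chainMessage (X : Node n → Store (PlayerPort n)) (w : Node n) (i : Fin n) : List Bool :=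
  match route κ w i with
  | none => []
  | some b => X (b, i) (Reg.port (PlayerPort.send w.2))

/-- Delivery of all messages. -/
def chainDeliver (X : Node n → Store (PlayerPort n)) (w : Node n) : Store (PlayerPort n)
  | Reg.port (PlayerPort.recv i) => chainMessage κ X w i
  | x => X w x

/-- The contents of all registers at the end. -/
noncomputable def chainFinal (k : ℕ) (X : Node n → Store (PlayerPort n)) :
    Node n → Store (PlayerPort n) :=
  chainCompute Δ k ((fun Y => chainDeliver κ (chainCompute Δ k Y))^[Δ.rounds k] X)

/-- The distribution of the output of the node `w`. -/
noncomputable def chainOutput (sid : List Bool) (w : Node n) (k : ℕ) : PMF (List Bool) :=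
  (Δ.setup k).bind fun s => (PMF.uniformOfFintype (NodeCoins Δ k)).map fun r =>
    chainFinal Δ κ k (chainInitial Δ sid s r) w (Reg.port PlayerPort.result)

end Chain

/-! ### An adversary that simulates the chain -/

instance {n : ℕ} : Finite (PlayerPort n) :=
  Finite.of_injective
    (fun
      | PlayerPort.recv j => Sum.inl (true, j)
      | PlayerPort.send j => Sum.inl (false, j)
      | PlayerPort.setup => Sum.inr 0
      | PlayerPort.sid => Sum.inr 1
      | PlayerPort.input => Sum.inr 2
      | PlayerPort.result => Sum.inr 3 : PlayerPort n → (Bool × Fin n) ⊕ Fin 4)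
    (by rintro (_ | _ | _ | _ | _ | _) (_ | _ | _ | _ | _ | _) h <;> simp_all)

instance {P : Type} [Countable P] : Countable (Reg P) :=
  Function.Injective.countable
    (f := (fun
      | Reg.sec => Sum.inr none
      | Reg.coin i => Sum.inl (true, i)
      | Reg.work i => Sum.inl (false, i)
      | Reg.port p => Sum.inr (some p) : Reg P → (Bool × ℕ) ⊕ Option P))
    (by rintro (_ | _ | _ | _) (_ | _ | _ | _) h <;> simp_all)

/-- Numbers of the work registers of the adversary: registers of simulated nodes, and two more. -/
noncomputable def workNumber (n : ℕ) : (Node n × Reg (PlayerPort n)) ⊕ Bool → ℕ :=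
  (exists_injective_nat _).choose

theorem workNumber_injective (n : ℕ) : Function.Injective (workNumber n) :=
  (exists_injective_nat _).choose_spec

/-- The register that represents a register of a simulated node. -/
noncomputable def simReg {n : ℕ} (a : Node n × Reg (PlayerPort n)) : Reg (AdvPort 2 n) :=
  Reg.work (workNumber n (Sum.inl a))

/-- The register that is nonempty after the first activation. -/
noncomputable def flagReg (n : ℕ) : Reg (AdvPort 2 n) := Reg.work (workNumber n (Sum.inr true))

/-- A register that stays empty. -/
noncomputable def emptyReg (n : ℕ) : Reg (AdvPort 2 n) := Reg.work (workNumber n (Sum.inr false))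

theorem simReg_injective {n : ℕ} : Function.Injective (simReg (n := n)) := fun a b h => by
  simpa [simReg, (workNumber_injective n).eq_iff] using h

theorem simReg_ne_flagReg {n : ℕ} (a : Node n × Reg (PlayerPort n)) : simReg a ≠ flagReg n := by
  simp [simReg, flagReg, (workNumber_injective n).eq_iff]

theorem simReg_ne_emptyReg {n : ℕ} (a : Node n × Reg (PlayerPort n)) : simReg a ≠ emptyReg n := by
  simp [simReg, emptyReg, (workNumber_injective n).eq_iff]

theorem emptyReg_ne_flagReg {n : ℕ} : emptyReg n ≠ flagReg n := by
  simp [emptyReg, flagReg, (workNumber_injective n).eq_iff]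

section Adversary

variable {n : ℕ} (Δ : Protocol n) (κ : Fin n → Option Bool) (β : Bool) (I : Finset (Fin n))
  (node : Fin n → Bool)

/-- The random tapes of all nodes. -/
abbrev TapeIndex : Type := Σ w : Node n, Fin (Δ.machine w.2).tapes

/-- The node is realized by a process of the first execution that is not Byzantine. -/
def IsReal (w : Node n) : Prop := w.2 ∉ I ∧ w.1 = node w.2

instance : DecidablePred (IsReal I node) := fun w => by unfold IsReal; infer_instance

/-- Where the adversary finds the initial contents of a register of a node, if the General's inputs
are `β` in the first and `!β` in the second execution. -/
noncomputable def initialSource (a : Node n × Reg (PlayerPort n)) : Reg (AdvPort 2 n) :=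
  match a.2 with
  | Reg.sec => Reg.sec
  | Reg.coin j =>
      if h : j < (Δ.machine a.1.2).tapes then
        Reg.coin (Fintype.equivFin (TapeIndex Δ) ⟨a.1, ⟨j, h⟩⟩) else emptyReg n
  | Reg.work _ => emptyReg n
  | Reg.port PlayerPort.setup => Reg.port (AdvPort.setup a.1.2)
  | Reg.port PlayerPort.sid => Reg.port (AdvPort.sid 0)
  | Reg.port PlayerPort.input =>
      if a.1.2 = Δ.general then Reg.port (AdvPort.input (if a.1.1 = β then 0 else 1))
      else emptyReg n
  | Reg.port (PlayerPort.recv _) => emptyReg n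
  | Reg.port (PlayerPort.send _) => emptyReg n
  | Reg.port PlayerPort.result => emptyReg n

/-- The registers of a node that need not be empty in the beginning. -/
abbrev InitialIndex : Type := Σ w : Node n, Fin (Δ.machine w.2).tapes ⊕ Option (PlayerPort n)

/-- The register described by an index. -/
def initialReg (a : InitialIndex Δ) : Node n × Reg (PlayerPort n) :=
  (a.1, match a.2 with
    | Sum.inl j => Reg.coin j
    | Sum.inr none => Reg.sec
    | Sum.inr (some p) => Reg.port p)

theorem initialReg_injective : Function.Injective (initialReg Δ) := by
  rintro ⟨w, x⟩ ⟨w', y⟩ h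
  obtain ⟨rfl, h⟩ := Prod.mk.inj h
  rcases x with _ | _ | _ <;> rcases y with _ | _ | _ <;> simp_all [Fin.ext_iff]

/-- Copy the initial contents of the registers of the simulated nodes. -/
noncomputable def simFill : Store (AdvPort 2 n) → Store (AdvPort 2 n) :=
  assign (fun a : InitialIndex Δ => simReg (initialReg Δ a))
    (fun a => initialSource Δ β (initialReg Δ a))

/-- Set up the simulated nodes. -/
noncomputable def simInit (σ : Store (AdvPort 2 n)) : Store (AdvPort 2 n) :=
  (simFill Δ β σ).set (flagReg n) (simFill Δ β σ (Reg.port (AdvPort.input 0)))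

/-- Where the adversary finds the message from player `a.2` to the simulated node `a.1`. -/
noncomputable def loadSource (a : Node n × Fin n) : Reg (AdvPort 2 n) :=
  match route κ a.1 a.2 with
  | none => emptyReg n
  | some b =>
      if IsReal I node (b, a.2) then Reg.port (AdvPort.recv 0 a.1.2 a.2)
      else simReg ((b, a.2), Reg.port (PlayerPort.send a.1.2))

/-- Deliver the messages to the simulated nodes. -/
noncomputable def simLoad : Store (AdvPort 2 n) → Store (AdvPort 2 n) :=
  assign (fun a : Node n × Fin n => simReg (a.1, Reg.port (PlayerPort.recv a.2)))
    (loadSource κ I node)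

/-- Where the adversary finds the message from player `a.1` to the real process of `a.2`. -/
noncomputable def exportSource (a : Fin n × Fin n) : Reg (AdvPort 2 n) :=
  match route κ (node a.2, a.2) a.1 with
  | none => emptyReg n
  | some b => simReg ((b, a.1), Reg.port (PlayerPort.send a.2))

/-- Write the messages of the simulated nodes to the ports of the adversary. -/
noncomputable def simExport : Store (AdvPort 2 n) → Store (AdvPort 2 n) :=
  assign (fun a : Fin n × Fin n => Reg.port (AdvPort.send 0 a.1 a.2)) (exportSource κ node)

/-- Preparation of the simulated nodes for their next activation. -/
noncomputable def simPrepare (σ : Store (AdvPort 2 n)) : Store (AdvPort 2 n) :=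
  simLoad κ I node (if σ (flagReg n) = [] then simInit Δ β σ else σ)

theorem simReg_ne_initialSource (b c : Node n × Reg (PlayerPort n)) :
    simReg b ≠ initialSource Δ β c := by
  unfold initialSource
  split <;> (try split_ifs) <;> first | exact simReg_ne_emptyReg b | simp [simReg]

theorem simFill_of_ne (σ : Store (AdvPort 2 n)) {y : Reg (AdvPort 2 n)}
    (hy : ∀ a, simReg a ≠ y) : simFill Δ β σ y = σ y :=
  assign_of_ne _ _ σ fun _ => hy _

theorem polyTime_simInit : PolyTime (simInit Δ β) :=
  PolyTime.comp (f := simFill Δ β) (PolyTime.copy (flagReg n) (Reg.port (AdvPort.input 0)))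
    (polyTime_assign (fun _ _ h => initialReg_injective Δ (simReg_injective h))
      fun _ _ => simReg_ne_initialSource Δ β _ _)
    fun σ => simFill_of_ne Δ β σ (by simp [simReg])

theorem polyTime_simLoad : PolyTime (simLoad κ I node) := by
  refine polyTime_assign (fun a b h => ?_) fun a b => ?_
  · have := simReg_injective h
    simp only [Prod.mk.injEq, Reg.port.injEq, PlayerPort.recv.injEq] at this
    exact Prod.ext this.1 this.2
  · unfold loadSource
    split
    · exact simReg_ne_emptyReg _
    · split_ifs
      · simp [simReg]
      · exact fun h => by simpa using simReg_injective h

theorem polyTime_simExport : PolyTime (simExport κ node) := by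
  refine polyTime_assign (fun a b h => ?_) fun a b => ?_
  · simp only [Reg.port.injEq, AdvPort.send.injEq, true_and] at h
    exact Prod.ext h.1 h.2
  · unfold exportSource
    split <;> simp [simReg, emptyReg]

theorem simInit_sec (σ : Store (AdvPort 2 n)) : simInit Δ β σ Reg.sec = σ Reg.sec := by
  rw [simInit, Store.set_of_ne _ _ (by simp [flagReg]), simFill_of_ne _ _ _ (by simp [simReg])]

theorem simPrepare_sec (σ : Store (AdvPort 2 n)) :
    simPrepare Δ κ β I node σ Reg.sec = σ Reg.sec := by
  rw [simPrepare, simLoad, assign_of_ne _ _ _ (by simp [simReg])]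
  split_ifs
  · exact simInit_sec Δ β σ
  · rfl

theorem polyTime_simPrepare : PolyTime (simPrepare Δ κ β I node) := by
  refine PolyTime.comp (f := fun σ => if σ (flagReg n) = [] then simInit Δ β σ else σ)
    (polyTime_simLoad κ I node) (PolyTime.ite_eq_nil _ (polyTime_simInit Δ β) PolyTime.id)
    fun σ => ?_
  split_ifs
  · exact simInit_sec Δ β σ
  · rfl

theorem activateAll_sec (σ : Store (AdvPort 2 n)) :
    activateAll (fun w : Node n => Δ.machine w.2) simReg σ Reg.sec = σ Reg.sec :=
  Function.extend_apply' _ _ _ (by rintro ⟨a, h⟩; simp [simReg] at h)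

/-- The adversary that simulates all nodes of the chain and connects those that are not real with
the real ones. -/
noncomputable def chainAdversary : Machine (AdvPort 2 n) where
  step σ := simExport κ node (activateAll (fun w : Node n => Δ.machine w.2) simReg
    (simPrepare Δ κ β I node σ))
  polyTime := PolyTime.comp (polyTime_simExport κ node)
    (PolyTime.comp (polyTime_activateAll _ simReg_injective fun a => by simp [simReg])
      (polyTime_simPrepare Δ κ β I node) (simPrepare_sec Δ κ β I node))
    fun σ => by rw [activateAll_sec, simPrepare_sec]
  tapes := Fintype.card (TapeIndex Δ)
  tapeLen x := (Δ.machine ((Fintype.equivFin (TapeIndex Δ)).symm x).1.2).tapeLen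
    ((Fintype.equivFin (TapeIndex Δ)).symm x).2

/-- The random tapes of the adversary serve as those of the nodes. -/
noncomputable def adversaryCoins (k : ℕ) :
    (chainAdversary Δ κ β I node).Tapes k ≃ NodeCoins Δ k :=
  (Equiv.piCongrLeft (fun y : TapeIndex Δ => Fin (((Δ.machine y.1.2).tapeLen y.2).eval k) → Bool)
    (Fintype.equivFin (TapeIndex Δ)).symm).trans
    (Equiv.piCurry fun (w : Node n) (j : Fin (Δ.machine w.2).tapes) =>
      Fin (((Δ.machine w.2).tapeLen j).eval k) → Bool)

theorem tapeString_chainAdversary {k : ℕ} (r : (chainAdversary Δ κ β I node).Tapes k)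
    (w : Node n) (j : ℕ) (hj : j < (Δ.machine w.2).tapes) :
    (chainAdversary Δ κ β I node).tapeString r (Fintype.equivFin (TapeIndex Δ) ⟨w, ⟨j, hj⟩⟩) =
      (Δ.machine w.2).tapeString (adversaryCoins Δ κ β I node k r w) j := by
  have key : ∀ (x : Fin (Fintype.card (TapeIndex Δ))) (y : TapeIndex Δ),
      (Fintype.equivFin (TapeIndex Δ)).symm x = y →
      (chainAdversary Δ κ β I node).tapeString r x =
        List.ofFn (adversaryCoins Δ κ β I node k r y.1 y.2) := by
    rintro x _ rfl
    rw [Machine.tapeString, dif_pos (show (x : ℕ) < (chainAdversary Δ κ β I node).tapes from x.2)]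
    refine congrArg List.ofFn ?_
    exact (Equiv.piCongrLeft_apply_apply
      (fun y : TapeIndex Δ => Fin (((Δ.machine y.1.2).tapeLen y.2).eval k) → Bool)
      (Fintype.equivFin (TapeIndex Δ)).symm r x).symm
  rw [key _ _ (Equiv.symm_apply_apply _ _), Machine.tapeString, dif_pos hj]

end Adversary

/-! ### The attacked execution reproduces the chain -/

section Simulation

variable {n : ℕ} (Δ : Protocol n) (κ : Fin n → Option Bool) (β : Bool) (I : Finset (Fin n))
  (node : Fin n → Bool)

/-- The honest processes of the first execution, with Byzantine players `I`, are among the nodes of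
the chain, and the players of all other nodes are corrupted. -/
structure Embeds (C : Corruption 2 n) : Prop where
  byzantine : C 0 = I
  live : ∀ i ∉ I, Live κ (node i, i)
  route_real : ∀ i ∉ I, ∀ j ∉ I, route κ (node j, j) i = some (node i)
  corrupt : ∀ w, Live κ w → ¬ IsReal I node w → w.2 ∈ C.players
  general : Δ.general ∉ I → node Δ.general = β

/-- The configuration at the beginning of a round represents the state `X` of the chain. -/
structure Tracks (k : ℕ) (S : Config 2 n) (X : Node n → Store (PlayerPort n)) : Prop where
  proc : ∀ i ∉ I, S.proc 0 i = X (node i, i)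
  sim : ∀ w, Live κ w → ¬ IsReal I node w → ∀ x,
    simPrepare Δ κ β I node S.adv (simReg (w, x)) = X w x
  flag : simPrepare Δ κ β I node S.adv (flagReg n) ≠ []
  empty : simPrepare Δ κ β I node S.adv (emptyReg n) = []
  sec : S.adv Reg.sec = unary k

/-- The configuration before delivery represents the state `X` of the chain. -/
structure TracksSent (k : ℕ) (S : Config 2 n) (X : Node n → Store (PlayerPort n)) : Prop where
  proc : ∀ i ∉ I, S.proc 0 i = X (node i, i)
  sim : ∀ w, Live κ w → ¬ IsReal I node w → ∀ x, S.adv (simReg (w, x)) = X w x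
  flag : S.adv (flagReg n) ≠ []
  empty : S.adv (emptyReg n) = []
  sec : S.adv Reg.sec = unary k
  sent : ∀ i ∈ I, ∀ j ∉ I,
    S.adv (Reg.port (AdvPort.send 0 i j)) = chainMessage κ X (node j, j) i

variable {Δ κ β I node}

theorem simLoad_of_ne (σ : Store (AdvPort 2 n)) {y : Reg (AdvPort 2 n)}
    (hy : ∀ w i, simReg (w, Reg.port (PlayerPort.recv i)) ≠ y) : simLoad κ I node σ y = σ y :=
  assign_of_ne _ _ σ fun _ => hy _ _

theorem simLoad_simReg_of_ne (σ : Store (AdvPort 2 n)) (w : Node n) {x : Reg (PlayerPort n)}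
    (hx : ∀ i, x ≠ Reg.port (PlayerPort.recv i)) :
    simLoad κ I node σ (simReg (w, x)) = σ (simReg (w, x)) :=
  simLoad_of_ne σ fun _ i h => hx i (Prod.mk.inj (simReg_injective h)).2.symm

theorem simLoad_simReg_recv (σ : Store (AdvPort 2 n)) (w : Node n) (i : Fin n) :
    simLoad κ I node σ (simReg (w, Reg.port (PlayerPort.recv i))) =
      σ (loadSource κ I node (w, i)) := by
  refine assign_target (a := ((w, i) : Node n × Fin n)) (fun a b h => ?_) _ σ
  have := simReg_injective h
  simp only [Prod.mk.injEq, Reg.port.injEq, PlayerPort.recv.injEq] at this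
  exact Prod.ext this.1 this.2

theorem simPrepare_of_flag {σ : Store (AdvPort 2 n)} (h : σ (flagReg n) ≠ []) :
    simPrepare Δ κ β I node σ = simLoad κ I node σ := by
  rw [simPrepare, if_neg h]

/-- `Tracks` looks at the adversary through `simPrepare` because initialization and the loading of
received messages are postponed to the next activation. What remains of that activation is the local
computation of the nodes and the export of their messages. -/
theorem Tracks.compute {C : Corruption 2 n} (hE : Embeds Δ κ β I node C) {k : ℕ}
    {S : Config 2 n} {X : Node n → Store (PlayerPort n)} (h : Tracks Δ κ β I node k S X) :
    TracksSent κ I node k (compute Δ C (chainAdversary Δ κ β I node) k S)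
      (chainCompute Δ k X) := by
  have hadv : (ABG.compute Δ C (chainAdversary Δ κ β I node) k S).adv = simExport κ node
      (activateAll (fun w : Node n => Δ.machine w.2) simReg
        (simPrepare Δ κ β I node S.adv)) := by
    simp only [ABG.compute, Machine.activate, chainAdversary, Store.set_self _ h.sec]
  have hexp : ∀ (σ : Store (AdvPort 2 n)) m, simExport κ node σ (Reg.work m) =
      σ (Reg.work m) := fun σ m => assign_of_ne _ _ σ (by simp)
  have hsim : ∀ w, Live κ w → ¬ IsReal I node w → ∀ x,
      activateAll (fun w : Node n => Δ.machine w.2) simReg (simPrepare Δ κ β I node S.adv)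
        (simReg (w, x)) = chainCompute Δ k X w x := by
    intro w hw hr x
    rw [activateAll, simReg_injective.extend_apply, simPrepare_sec, h.sec, chainCompute,
      Machine.activate]
    simp only [h.sim w hw hr]
  have hother : ∀ (σ : Store (AdvPort 2 n)) y, (∀ a, simReg a ≠ y) →
      activateAll (fun w : Node n => Δ.machine w.2) simReg σ y = σ y := fun σ y hy =>
    Function.extend_apply' _ _ _ (by rintro ⟨a, h⟩; exact hy a h)
  have hempty : activateAll (fun w : Node n => Δ.machine w.2) simReg
      (simPrepare Δ κ β I node S.adv) (emptyReg n) = [] := by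
    rw [hother _ _ simReg_ne_emptyReg, h.empty]
  refine ⟨fun i hi => ?_, fun w hw hr x => ?_, ?_, ?_, ?_, fun i hi j hj => ?_⟩
  · simp only [ABG.compute, hE.byzantine, if_neg hi, chainCompute, h.proc i hi]
  · rw [hadv, ← hsim w hw hr, simReg, hexp]
  · rw [hadv, flagReg, hexp, ← flagReg, hother _ _ simReg_ne_flagReg]
    exact h.flag
  · rw [hadv, emptyReg, hexp, ← emptyReg, hempty]
  · rw [hadv, simExport, assign_of_ne _ _ _ (by simp), activateAll_sec, simPrepare_sec, h.sec]
  · rw [hadv, simExport, chainMessage]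
    refine (assign_target (a := ((i, j) : Fin n × Fin n)) (fun a b h => ?_) _ _).trans ?_
    · simp only [Reg.port.injEq, AdvPort.send.injEq, true_and] at h
      exact Prod.ext h.1 h.2
    · rw [exportSource]
      rcases hroute : route κ (node j, j) i with _ | b
      · exact hempty
      -- The sender is Byzantine, hence not real, and it is live because a live node hears from it;
      -- so its simulated copy is correct.
      · exact hsim (b, i) ((hE.live j hj).of_route hroute) (fun hr => hr.1 hi) _

/-- There are four kinds of links. Real to real is ordinary delivery, simulated to real uses the
exported messages, real to simulated uses what a corrupted player receives, and simulated to
simulated is copied internally. -/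
theorem TracksSent.deliver {C : Corruption 2 n} (hE : Embeds Δ κ β I node C) {k : ℕ}
    {S : Config 2 n} {X : Node n → Store (PlayerPort n)} (h : TracksSent κ I node k S X) :
    Tracks Δ κ β I node k (deliver C S) (chainDeliver κ X) := by
  have hflag : (ABG.deliver C S).adv (flagReg n) ≠ [] := h.flag
  refine ⟨fun i hi => ?_, fun w hw hr x => ?_, ?_, ?_, h.sec⟩
  · funext x
    rcases x with _ | _ | _ | (j | _ | _ | _ | _ | _) <;>
      simp only [ABG.deliver, chainDeliver, h.proc i hi]
    rw [message, hE.byzantine]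
    split_ifs with hj
    · exact h.sent j hj i hi
    · rw [h.proc j hj, chainMessage, hE.route_real j hj i hi]
  · rw [simPrepare_of_flag hflag]
    by_cases hx : ∃ i, x = Reg.port (PlayerPort.recv i)
    · obtain ⟨i, rfl⟩ := hx
      rw [simLoad_simReg_recv, loadSource]
      simp only [chainDeliver, chainMessage]
      rcases hroute : route κ w i with _ | b
      · exact h.empty
      · simp only
        split_ifs with hreal
        · obtain ⟨hi, hb⟩ := hreal
          simp only at hi hb
          subst hb
          -- The player of the simulated node `w` is corrupted, so the adversary sees the message
          -- that the real process sends to it.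
          simp only [ABG.deliver, message, hE.byzantine, if_pos (hE.corrupt w hw hr), if_neg hi,
            h.proc i hi]
        · exact h.sim (b, i) (hw.of_route hroute) hreal _
    · push Not at hx
      rw [simLoad_simReg_of_ne _ _ hx]
      refine (h.sim w hw hr x).trans ?_
      rcases x with _ | _ | _ | (j | _ | _ | _ | _ | _) <;> first | rfl | exact absurd rfl (hx j)
  · rw [simPrepare_of_flag hflag, simLoad_of_ne _ fun w i => simReg_ne_flagReg _]
    exact hflag
  · rw [simPrepare_of_flag hflag, simLoad_of_ne _ fun w i => simReg_ne_emptyReg _]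
    exact h.empty

theorem simFill_simReg (σ : Store (AdvPort 2 n)) (hσ : ∀ m, σ (Reg.work m) = [])
    (a : Node n × Reg (PlayerPort n)) :
    simFill Δ β σ (simReg a) = σ (initialSource Δ β a) := by
  by_cases ha : ∃ x, initialReg Δ x = a
  · obtain ⟨x, rfl⟩ := ha
    exact assign_target (a := x)
      (fun _ _ h => initialReg_injective Δ (simReg_injective h)) _ σ
  · rw [simFill, assign_of_ne _ _ _ fun x h => ha ⟨x, simReg_injective h⟩]
    obtain ⟨w, x⟩ := a
    rcases x with _ | j | m | p
    · exact (ha ⟨⟨w, Sum.inr none⟩, rfl⟩).elim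
    -- A register beyond the random tapes is not filled; it is empty, as is the source assigned to
    -- it.
    · have hj : ¬ j < (Δ.machine w.2).tapes := fun hj => ha ⟨⟨w, Sum.inl ⟨j, hj⟩⟩, rfl⟩
      simp only [initialSource, dif_neg hj]
      exact (hσ _).trans (hσ _).symm
    · exact (hσ _).trans (hσ _).symm
    · exact (ha ⟨⟨w, Sum.inr (some p)⟩, rfl⟩).elim

variable (Δ κ β I node) in
/-- The random tapes of the nodes in a real execution. -/
noncomputable def pullCoins {k : ℕ} (r : Coins Δ (chainAdversary Δ κ β I node) (m := 2) k) :
    NodeCoins Δ k := fun w =>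
  if IsReal I node w then r.1 0 w.2 else adversaryCoins Δ κ β I node k r.2 w

theorem tracks_initial {C : Corruption 2 n} (hE : Embeds Δ κ β I node C)
    (sid : Fin 2 → List Bool) {k : ℕ} (s : Fin n → List Bool)
    (r : Coins Δ (chainAdversary Δ κ β I node) (m := 2) k) :
    Tracks Δ κ β I node k
      (initial Δ C (chainAdversary Δ κ β I node) sid ![β, !β] s r)
      (chainInitial Δ (sid 0) s (pullCoins Δ κ β I node r)) := by
  set S := initial Δ C (chainAdversary Δ κ β I node) sid ![β, !β] s r with hS
  have hwork : ∀ m, S.adv (Reg.work m) = [] := fun m => rfl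
  have hprep : simPrepare Δ κ β I node S.adv = simLoad κ I node (simInit Δ β S.adv) := by
    rw [simPrepare, flagReg, if_pos (hwork _)]
  have hinit : ∀ y, y ≠ flagReg n → simInit Δ β S.adv y = simFill Δ β S.adv y := fun y hy =>
    Store.set_of_ne _ _ hy
  have hsim : ∀ w, Live κ w → ¬ IsReal I node w → ∀ x, simInit Δ β S.adv (simReg (w, x)) =
      chainInitial Δ (sid 0) s (pullCoins Δ κ β I node r) w x := by
    intro w hw hr x
    rw [hinit _ (simReg_ne_flagReg _), simFill_simReg _ hwork]
    rcases x with _ | j | m | (_ | _ | _ | _ | _ | _)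
    · rfl
    · simp only [initialSource, chainInitial, Machine.start, pullCoins, if_neg hr]
      split_ifs with hj
      · exact tapeString_chainAdversary Δ κ β I node r.2 w j hj
      · rw [Machine.tapeString, dif_neg hj]
        exact hwork _
    · exact hwork _
    · exact hwork _
    · exact hwork _
    · exact if_pos (hE.corrupt w hw hr)
    · rfl
    · simp only [initialSource, chainInitial, Machine.start]
      split_ifs with hg hb
      · rw [hb]; rfl
      -- The opposite bit is the General's input in the second execution.
      · have : w.1 = !β := by cases h : w.1 <;> cases β <;> simp_all
        rw [this]; rfl
      · exact hwork _
    · exact hwork _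
  have hempty : simInit Δ β S.adv (emptyReg n) = [] := by
    rw [hinit _ emptyReg_ne_flagReg, simFill_of_ne _ _ _ simReg_ne_emptyReg]
    exact hwork _
  refine ⟨fun i hi => ?_, fun w hw hr x => ?_, ?_, ?_, rfl⟩
  · have hc : pullCoins Δ κ β I node r (node i, i) = r.1 0 i := if_pos ⟨hi, rfl⟩
    simp only [hS, initial, chainInitial, hc]
    congr 1
    funext p
    rcases p with _ | _ | _ | _ | _ | _ <;> try rfl
    simp only [Matrix.cons_val_zero]
    split_ifs with hg
    · subst hg; rw [hE.general hi]
    · rfl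
  · rw [hprep]
    by_cases hx : ∃ i, x = Reg.port (PlayerPort.recv i)
    · obtain ⟨i, rfl⟩ := hx
      -- The first activation also loads messages, but every possible source is still empty, as in
      -- the initial state of the chain.
      rw [simLoad_simReg_recv, loadSource]
      rcases hroute : route κ w i with _ | b
      · exact hempty
      · simp only
        split_ifs with hreal
        · rw [hinit _ (by simp [flagReg]), simFill_of_ne _ _ _ (by simp [simReg])]
          rfl
        · exact hsim (b, i) (hw.of_route hroute) hreal _
    · push Not at hx
      rw [simLoad_simReg_of_ne _ _ hx, hsim w hw hr]
  -- The flag receives the string `[β]`, which is nonempty for either bit.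
  · rw [hprep, simLoad_of_ne _ fun w i => simReg_ne_flagReg _, simInit, Store.set_same,
      simFill_of_ne _ _ _ (by simp [simReg])]
    exact List.cons_ne_nil _ _
  · rw [hprep, simLoad_of_ne _ fun w i => simReg_ne_emptyReg _, hempty]

theorem output_final_eq {C : Corruption 2 n} (hE : Embeds Δ κ β I node C)
    (sid : Fin 2 → List Bool) {k : ℕ} (s : Fin n → List Bool)
    (r : Coins Δ (chainAdversary Δ κ β I node) (m := 2) k) {i : Fin n} (hi : i ∉ I) :
    output C (final Δ C (chainAdversary Δ κ β I node) k
      (initial Δ C (chainAdversary Δ κ β I node) sid ![β, !β] s r)) 0 i =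
    chainFinal Δ κ k (chainInitial Δ (sid 0) s (pullCoins Δ κ β I node r)) (node i, i)
      (Reg.port PlayerPort.result) := by
  have h : ∀ m, Tracks Δ κ β I node k
      ((fun T => deliver C (compute Δ C (chainAdversary Δ κ β I node) k T))^[m]
        (initial Δ C (chainAdversary Δ κ β I node) sid ![β, !β] s r))
      ((fun Y => chainDeliver κ (chainCompute Δ k Y))^[m]
        (chainInitial Δ (sid 0) s (pullCoins Δ κ β I node r))) := by
    intro m
    induction m with
    | zero => exact tracks_initial hE sid s r
    | succ m ih =>
      rw [Function.iterate_succ_apply', Function.iterate_succ_apply']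
      exact (ih.compute hE).deliver hE
  rw [output, hE.byzantine, if_neg hi, final, ((h _).compute hE).proc i hi, chainFinal]

-- Each node draws on tapes of its own, either those of a real process or a part of the adversary's;
-- the remaining tapes are not used. `pullCoins` is thus a projection of a product.
variable (Δ κ β I node) in
theorem map_pullCoins (k : ℕ) :
    (PMF.uniformOfFintype (Coins Δ (chainAdversary Δ κ β I node) (m := 2) k)).map
      (pullCoins Δ κ β I node) = PMF.uniformOfFintype (NodeCoins Δ k) := by
  set q := adversaryCoins Δ κ β I node k with hq
  -- Overwrite exactly the tapes that `pullCoins` reads and keep the others.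
  refine map_uniformOfFintype_of_lens _ (fun c r =>
    (fun e i => if e = 0 ∧ i ∉ I then c (node i, i) else r.1 e i,
      q.symm fun w => if IsReal I node w then q r.2 w else c w)) (fun c r => ?_) (fun r => ?_)
    (fun c c' r => ?_)
  · funext w
    simp only [pullCoins, ← hq, Equiv.apply_symm_apply]
    split_ifs with hw h
    · obtain ⟨b, i⟩ := w
      have hb : b = node i := hw.2
      rw [hb]
    · exact (h ⟨trivial, hw.1⟩).elim
    · rfl
  · refine Prod.ext ?_ ?_
    · funext e i
      simp only
      split_ifs with h
      · obtain ⟨rfl, hi⟩ := h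
        exact if_pos ⟨hi, rfl⟩
      · rfl
    · simp only
      rw [Equiv.symm_apply_eq]
      funext w
      split_ifs with h
      · rfl
      · exact if_neg h
  · refine Prod.ext ?_ ?_
    · funext e i
      simp only
      split_ifs <;> rfl
    · simp only [Equiv.apply_symm_apply]
      congr 1
      funext w
      split_ifs <;> rfl

theorem map_real_eq {C : Corruption 2 n} (hE : Embeds Δ κ β I node C)
    (sid : Fin 2 → List Bool) (k : ℕ) {i : Fin n} (hi : i ∉ I) :
    (real Δ C (chainAdversary Δ κ β I node) sid 0 k ![β, !β]).map (fun x => x i) =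
      chainOutput Δ κ (sid 0) (node i, i) k := by
  rw [real, PMF.map_bind, chainOutput]
  congr 1
  funext s
  rw [PMF.map_comp, ← map_pullCoins Δ κ β I node, PMF.map_comp]
  congr 1
  funext r
  exact output_final_eq hE sid s r hi

end Simulation

/-! ### Impossibility -/

/-- The probability that the node `w` outputs `0`. -/
noncomputable def chainZero {n : ℕ} (Δ : Protocol n) (κ : Fin n → Option Bool) (sid : List Bool)
    (w : Node n) (k : ℕ) : ℝ :=
  (chainOutput Δ κ sid w k [false]).toReal

section Impossibility

variable {n : ℕ} {Δ : Protocol n} {κ : Fin n → Option Bool} {β : Bool} {I : Finset (Fin n)}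
  {node : Fin n → Bool} {sid : Fin 2 → List Bool} {adm : Corruption 2 n → Prop}
  {C : Corruption 2 n}

/-- An honest player of an execution that is part of the chain outputs `0` with the same probability
as in an ideal process, up to a negligible function. -/
theorem exists_ideal (hΔ : ParallelABG Δ sid adm) (hC : adm C) (hE : Embeds Δ κ β I node C) :
    ∃ S : Machine (IdealPort 2 n), ∀ i ∉ I,
      Filter.Tendsto (fun k => |((ideal Δ.general I S (0 : Fin 2) k ![β, !β]).map
        (fun x => x i) [false]).toReal - chainZero Δ κ (sid 0) (node i, i) k|)
        Filter.atTop (nhds 0) := by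
  obtain ⟨S, hS⟩ := hΔ C hC (chainAdversary Δ κ β I node) 0
  refine ⟨S, fun i hi => ?_⟩
  -- The exponent 0 in the superpolynomial decay suffices: only convergence to zero is needed.
  have h := hS (zeroTest 2 i) ![β, !β] 0
  simpa only [acceptProb_zeroTest, map_real_eq hE sid _ hi, hE.byzantine, pow_zero, one_mul,
    chainZero] using h

/-- Validity carried over to the chain. -/
theorem chainZero_tendsto (hΔ : ParallelABG Δ sid adm) (hC : adm C)
    (hE : Embeds Δ κ β I node C) (hg : Δ.general ∉ I) {i : Fin n} (hi : i ∉ I) :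
    Filter.Tendsto (chainZero Δ κ (sid 0) (node i, i)) Filter.atTop
      (nhds (if β then 0 else 1)) := by
  obtain ⟨S, hS⟩ := exists_ideal hΔ hC hE
  have h := hS i hi
  simp only [ideal_map_of_general_honest hg hi] at h
  refine tendsto_iff_norm_sub_tendsto_zero.2 (h.congr fun k => ?_)
  rw [abs_sub_comm, Real.norm_eq_abs]
  cases β <;> simp [PMF.pure_apply]

/-- Agreement carried over to the chain: one ideal adversary serves both players, so the same ideal
probability cancels. -/
theorem chainZero_sub_tendsto (hΔ : ParallelABG Δ sid adm) (hC : adm C)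
    (hE : Embeds Δ κ β I node C) {i j : Fin n} (hi : i ∉ I) (hj : j ∉ I) :
    Filter.Tendsto (fun k => chainZero Δ κ (sid 0) (node i, i) k -
      chainZero Δ κ (sid 0) (node j, j) k) Filter.atTop (nhds 0) := by
  obtain ⟨S, hS⟩ := exists_ideal hΔ hC hE
  have h := (tendsto_zero_iff_abs_tendsto_zero _).2 (hS j hj)
  have h' := (tendsto_zero_iff_abs_tendsto_zero _).2 (hS i hi)
  simpa [ideal_map_eq Δ.general hi hj] using h.sub h'

end Impossibility

/-- The players of a given type. -/
def classOf {n : ℕ} (κ : Fin n → Option Bool) (a : Option Bool) : Finset (Fin n) :=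
  Finset.univ.filter fun i => κ i = a

/-- Impossibility for a division of the players into the class `none` of the General and two other
classes, provided the attacks are admissible in which one class is Byzantine in the first execution
and the class of the General is Byzantine in the second one. -/
theorem not_parallelABG_of_classes {n : ℕ} (Δ : Protocol n) (κ : Fin n → Option Bool)
    (sid : Fin 2 → List Bool) (adm : Corruption 2 n → Prop) (hg : κ Δ.general = none)
    (hne : ∀ b, ∃ i, κ i = some b) (hadm : ∀ a, adm ![classOf κ a, classOf κ none]) :
    ¬ ParallelABG Δ sid adm := by
  intro hΔ
  have hmem : ∀ a i, i ∈ classOf κ a ↔ κ i = a := by simp [classOf]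
  have hplayers : ∀ a i, i ∈ Corruption.players ![classOf κ a, classOf κ none] ↔
      κ i = a ∨ κ i = none := by
    intro a i
    simp [Corruption.players, Fin.exists_fin_two, hmem]
  -- An end of the path: copy `b` of the General's class and the class `some b` are honest. The
  -- adversary runs the class `some !b` and the other copy of the General's class, whose setup tapes
  -- it gets through the second execution.
  have hside : ∀ b : Bool, Embeds Δ κ b (classOf κ (some !b)) (fun _ => b)
      ![classOf κ (some !b), classOf κ none] := by
    intro b
    refine ⟨rfl, fun i hi => ?_, fun i hi j hj => ?_, fun w hw hr => ?_, fun _ => rfl⟩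
    · rw [hmem] at hi
      unfold Live
      rcases h : κ i with _ | c
      · simp
      · cases b <;> cases c <;> simp_all
    · rw [hmem] at hi hj
      unfold route
      rcases h : κ i with _ | c <;> rcases h' : κ j with _ | d <;> cases b <;>
        (try cases c) <;> (try cases d) <;> simp_all
    · rw [hplayers]
      obtain ⟨c, i⟩ := w
      unfold Live at hw
      unfold IsReal at hr
      rw [hmem] at hr
      rcases h : κ i with _ | d <;> cases b <;> cases c <;> (try cases d) <;> simp_all
  -- The middle of the path: both copies of the General's class are simulated. The default in `getD`
  -- concerns only this Byzantine class and is immaterial.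
  have hmid : Embeds Δ κ false (classOf κ none) (fun i => (κ i).getD false)
      ![classOf κ none, classOf κ none] := by
    refine ⟨rfl, fun i hi => ?_, fun i hi j hj => ?_, fun w hw hr => ?_, fun h => ?_⟩
    · rw [hmem] at hi
      unfold Live
      rcases h : κ i with _ | c <;> simp_all
    · rw [hmem] at hi hj
      unfold route
      rcases h : κ i with _ | c <;> rcases h' : κ j with _ | d <;> simp_all
    · rw [hplayers]
      obtain ⟨c, i⟩ := w
      unfold Live at hw
      unfold IsReal at hr
      rw [hmem] at hr
      rcases h : κ i with _ | d <;> simp_all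
    · exact (h ((hmem _ _).2 hg)).elim
  obtain ⟨i, hi⟩ := hne false
  obtain ⟨j, hj⟩ := hne true
  have h₀ := chainZero_tendsto hΔ (hadm _) (hside false) (by simp [hmem, hg])
    (i := i) (by simp [hmem, hi])
  have h₁ := chainZero_tendsto hΔ (hadm _) (hside true) (by simp [hmem, hg])
    (i := j) (by simp [hmem, hj])
  have h₂ := chainZero_sub_tendsto hΔ (hadm none) hmid (i := i) (j := j) (by simp [hmem, hi])
    (by simp [hmem, hj])
  simp only [hi, hj, Option.getD_some] at h₂
  -- The difference would tend both to 0 and to 1 - 0.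
  have := tendsto_nhds_unique h₂ (h₀.sub h₁)
  norm_num at this

/-- Divide the players into three nonempty classes of bounded sizes. -/
theorem exists_classes {n : ℕ} (hn : 3 ≤ n) (g : Fin n) {a b : ℕ} (ha : 0 < a) (hb : 0 < b)
    (h : n ≤ 2 * b + a) :
    ∃ κ : Fin n → Option Bool, κ g = none ∧ (∀ c, ∃ i, κ i = some c) ∧
      (classOf κ none).card ≤ a ∧ ∀ c, (classOf κ (some c)).card ≤ b := by
  classical
  -- The two classes are made as large as `b` permits, while one player is kept for each class still
  -- to be formed. What remains has one element or at most `n - 2 * b`.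
  set y := min b (n - 2) with hy
  set z := min b (n - 1 - y) with hz
  have hg : (Finset.univ.erase g).card = n - 1 := by
    rw [Finset.card_erase_of_mem (Finset.mem_univ g), Finset.card_univ, Fintype.card_fin]
  obtain ⟨B, hBg, hB⟩ := Finset.exists_subset_card_eq (s := Finset.univ.erase g) (n := y)
    (by omega)
  obtain ⟨C, hCg, hC⟩ := Finset.exists_subset_card_eq (s := Finset.univ.erase g \ B) (n := z)
    (by rw [Finset.card_sdiff_of_subset hBg]; omega)
  have hdisj : ∀ i ∈ C, i ∉ B := fun i hi => (Finset.mem_sdiff.1 (hCg hi)).2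
  have hgB : g ∉ B := fun h => by simpa using hBg h
  have hgC : g ∉ C := fun h => by simpa using hCg h
  let κ : Fin n → Option Bool := fun i =>
    if i ∈ B then some false else if i ∈ C then some true else none
  have hκB : classOf κ (some false) = B := by
    ext i
    by_cases h₁ : i ∈ B <;> by_cases h₂ : i ∈ C <;> simp [classOf, κ, h₁]
  have hκC : classOf κ (some true) = C := by
    ext i
    by_cases h₁ : i ∈ B
    · have h₂ : i ∉ C := fun h => hdisj i h h₁
      simp [classOf, κ, h₁, h₂]
    · by_cases h₂ : i ∈ C <;> simp [classOf, κ, h₁, h₂]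
  have hκA : classOf κ none = (B ∪ C)ᶜ := by
    ext i
    by_cases h₁ : i ∈ B <;> by_cases h₂ : i ∈ C <;> simp [classOf, κ, h₁, h₂]
  refine ⟨κ, by simp [κ, hgB, hgC], fun c => ?_, ?_, fun c => ?_⟩
  · have hpos : 0 < (classOf κ (some c)).card := by
      cases c
      · rw [hκB]; omega
      · rw [hκC]; omega
    obtain ⟨i, hi⟩ := Finset.card_pos.1 hpos
    exact ⟨i, by simpa [classOf] using hi⟩
  · rw [hκA, Finset.card_compl, Fintype.card_fin, Finset.card_union_of_disjoint
      (Finset.disjoint_right.2 hdisj)]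
    omega
  · cases c
    · rw [hκB]; omega
    · rw [hκC]; omega

end ABG

theorem mainTheorem3 (n : ℕ) (hn : 3 ≤ n)
    (sid : Fin 2 → List Bool) (hsid : Function.Injective sid) :
    (∀ t : ℕ, n < 2 * t →
      ¬ ∃ Δ : ABG.Protocol n, ABG.ParallelABG Δ sid (ABG.IsThreshold t)) ∧
    (∀ t₁ t₂ : ℕ, 0 < t₂ → n ≤ 2 * t₁ + min t₁ t₂ →
      ¬ ∃ Δ : ABG.Protocol n, ABG.ParallelABG Δ sid (ABG.IsPairThreshold t₁ t₂)) := by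
  refine ⟨fun t ht => ?_, fun t₁ t₂ ht₂ h => ?_⟩
  · rintro ⟨Δ, hΔ⟩
    -- The union of the General's class and another one may have `t` players. The General alone and
    -- classes of size `t - 1` cover `2 * t - 1` players, which suffices as `n < 2 * t`.
    obtain ⟨κ, hg, hne, hA, hBC⟩ := ABG.exists_classes hn Δ.general (a := 1) (b := t - 1)
      one_pos (by omega) (by omega)
    refine ABG.not_parallelABG_of_classes Δ κ sid _ hg hne (fun a => ?_) hΔ
    have hsub : ABG.Corruption.players ![ABG.classOf κ a, ABG.classOf κ none] ⊆
        ABG.classOf κ a ∪ ABG.classOf κ none := by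
      intro i
      simp [ABG.Corruption.players, Fin.exists_fin_two]
    refine (Finset.card_le_card hsub).trans ?_
    rcases a with _ | c
    · rw [Finset.union_self]; omega
    · have := hBC c
      exact (Finset.card_union_le _ _).trans (by omega)
  · rintro ⟨Δ, hΔ⟩
    -- The General's class is Byzantine in both executions in the middle attack, so both bounds
    -- apply to it; the other classes are Byzantine in the first execution only.
    obtain ⟨κ, hg, hne, hA, hBC⟩ := ABG.exists_classes hn Δ.general (a := min t₁ t₂) (b := t₁)
      (by omega) (by omega) h
    refine ABG.not_parallelABG_of_classes Δ κ sid _ hg hne (fun a => ⟨?_, ?_⟩) hΔ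
    · rcases a with _ | c
      · exact hA.trans (min_le_left _ _)
      · exact hBC c
    · exact hA.trans (min_le_right _ _)
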